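/- Let $m,\ell\ge 0$ be integers, let $\Omega\subset\mathbb{R}^m$ be full-dimensional, i.e. $\Omega$ contains a nonempty open subset of $\mathbb{R}^m$. Call a map $g:\Omega\to\mathbb{R}^\ell$ strictly left-invertible if there is a map $g^{-L}:g(\Omega)\to\Omega$ (not assumed continuous) satisfying $g^{-L}(g(x))=x$ for every $x\in\Omega$. (1) If $g:\Omega\to\mathbb{R}^\ell$ is continuous and strictly left-invertible, then $g$ is injective on $\Omega$. (2) If $\ell<m$, then there is no continuous strictly left-invertible map $g:\Omega\to\mathbb{R}^\ell$. -/

import Mathlib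

/-- `g : X → Y` is strictly left-invertible: there is a map from the image of `g` back to `X`
(not assumed continuous) that sends `g x` to `x` for every `x`. -/
def StrictlyLeftInvertible {X Y : Type*} (g : X → Y) : Prop :=
  ∃ gL : Set.range g → X, ∀ x : X, gL ⟨g x, Set.mem_range_self x⟩ = x

/-- A subset of `ℝ^m` is full-dimensional if it contains a nonempty open set of `ℝ^m`. -/
def IsFullDimensional {m : ℕ} (Ω : Set (EuclideanSpace ℝ (Fin m))) : Prop :=
  ∃ U : Set (EuclideanSpace ℝ (Fin m)), IsOpen U ∧ U.Nonempty ∧ U ⊆ Ω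

open MeasureTheory Metric Set Function
open scoped NNReal ContDiff

/-! A left inverse forces injectivity, so (2) reduces to excluding a continuous injection `g` of a
closed ball into a space of smaller dimension. By compactness `g` is a closed embedding, and Tietze
extends its inverse to a map `H` on the whole target. Smooth approximations `Q` of `H` and `γ` of
`g` make `Q ∘ γ` close to the identity on the ball. The range of the smooth `Q` has dense complement
for dimension reasons, so `Q ∘ γ - c` has no zero for some small `c`. This contradicts
`exists_eq_zero_of_norm_sub_le_of_contDiff`, which rests on the absence of a `C¹` retraction onto
the sphere. -/

theorem exists_polynomial_eval_eq_det_id_add_smul {E : Type*} [NormedAddCommGroup E]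
    [NormedSpace ℝ E] [FiniteDimensional ℝ E] (L : E →L[ℝ] E) :
    ∃ p : Polynomial ℝ, p.natDegree ≤ Module.finrank ℝ E ∧
      ∀ t : ℝ, p.eval t = (ContinuousLinearMap.id ℝ E + t • L).det := by
  let b := Module.finBasis ℝ E
  let M := LinearMap.toMatrix b b (L : E →ₗ[ℝ] E)
  refine ⟨((Polynomial.X : Polynomial ℝ) • M.map Polynomial.C +
    (1 : Matrix _ _ ℝ).map Polynomial.C).det, ?_, fun t ↦ ?_⟩
  · simpa using Polynomial.natDegree_det_X_add_C_le M 1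
  · rw [← Polynomial.coe_evalRingHom, RingHom.map_det, ContinuousLinearMap.det,
      ← LinearMap.det_toMatrix b]
    congr 1
    have hid : LinearMap.toMatrix b b (ContinuousLinearMap.id ℝ E : E →ₗ[ℝ] E) = 1 :=
      LinearMap.toMatrix_id b
    have hsum : LinearMap.toMatrix b b
        ((ContinuousLinearMap.id ℝ E + t • L : E →L[ℝ] E) : E →ₗ[ℝ] E) = 1 + t • M := by
      rw [ContinuousLinearMap.toLinearMap_add, ContinuousLinearMap.toLinearMap_smul,
        map_add (LinearMap.toMatrix b b), map_smul (LinearMap.toMatrix b b), hid]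
    rw [hsum]
    ext i j
    by_cases hij : i = j <;> simp [M, hij] <;> ring

/-- The integral of `det (1 + t A x)` is a polynomial in `t`, so it is constant as soon as it is
constant for small `t > 0`. -/
theorem setIntegral_det_id_add_eq_of_small {E : Type*} [NormedAddCommGroup E] [NormedSpace ℝ E]
    [FiniteDimensional ℝ E] [MeasurableSpace E] [BorelSpace E] (μ : Measure E) {s : Set E}
    {A : E → E →L[ℝ] E} (hA : ∀ t : ℝ, IntegrableOn
      (fun x ↦ (ContinuousLinearMap.id ℝ E + t • A x).det) s μ) {ε a : ℝ} (hε : 0 < ε)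
    (h : ∀ t, 0 < t → t < ε →
      ∫ x in s, (ContinuousLinearMap.id ℝ E + t • A x).det ∂μ = a) (t : ℝ) :
    ∫ x in s, (ContinuousLinearMap.id ℝ E + t • A x).det ∂μ = a := by
  set n := Module.finrank ℝ E + 1
  -- Distinct interpolation nodes in `(0, ε)`; the shift by 2 keeps the node at `i = 0` strictly
  -- below `ε`. The Lagrange weights do not depend on `x`, so interpolation commutes with the
  -- integral.
  let v : ℕ → ℝ := fun i ↦ ε / (i + 2)
  have hv0 (i : ℕ) : 0 < v i := by positivity
  have hvε (i : ℕ) : v i < ε := div_lt_self hε (by linarith [(Nat.cast_nonneg i : (0 : ℝ) ≤ i)])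
  have hv : InjOn v (Finset.range n) := by
    intro i _ j _ hij
    have : (i : ℝ) + 2 = j + 2 := by
      have := congrArg (fun y ↦ ε / y) hij
      simpa [v, div_div_cancel₀ hε.ne'] using this
    exact_mod_cast add_right_cancel this
  let c : ℕ → ℝ := fun i ↦ (Lagrange.basis (Finset.range n) v i).eval t
  have key (p : Polynomial ℝ) (hp : p.natDegree < n) :
      p.eval t = ∑ i ∈ Finset.range n, p.eval (v i) * c i := by
    have := Lagrange.eq_interpolate (f := p) hv
      (by
        rw [Finset.card_range]
        exact Polynomial.degree_le_natDegree.trans_lt (by exact_mod_cast hp))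
    conv_lhs => rw [this]
    simp [Lagrange.interpolate_apply, Polynomial.eval_finsetSum, c]
  have hdet (x : E) : (ContinuousLinearMap.id ℝ E + t • A x).det =
      ∑ i ∈ Finset.range n, (ContinuousLinearMap.id ℝ E + v i • A x).det * c i := by
    obtain ⟨p, hp, hpe⟩ := exists_polynomial_eval_eq_det_id_add_smul (A x)
    simpa only [hpe] using key p (Nat.lt_succ_of_le hp)
  have h1 := key (Polynomial.C a) (by simp [n])
  simp only [Polynomial.eval_C] at h1
  simp_rw [hdet]
  rw [integral_finsetSum _ fun i _ ↦ (hA (v i)).mul_const _, h1]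
  refine Finset.sum_congr rfl fun i _ ↦ ?_
  rw [integral_mul_const, h _ (hv0 i) (hvε i)]

/-- For small `t`, `x + t • v x` is a Lipschitz-small perturbation of the identity, hence bijective,
and it maps the ball onto itself; change of variables gives the volume. Polynomiality in `t` carries
this to `t = 1`, where injectivity may fail. -/
theorem setIntegral_ball_det_id_add_fderiv {E : Type*} [NormedAddCommGroup E] [NormedSpace ℝ E]
    [FiniteDimensional ℝ E] [MeasurableSpace E] [BorelSpace E] (μ : Measure E)
    [μ.IsAddHaarMeasure] {v : E → E} (hv : ContDiff ℝ 1 v) (hvc : HasCompactSupport v)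
    (hin : ∀ t : ℝ, 0 < t → t < 1 → ∀ x, ‖x‖ < 1 → ‖x + t • v x‖ < 1)
    (hout : ∀ t : ℝ, 0 < t → t < 1 → ∀ x, 1 ≤ ‖x‖ → 1 ≤ ‖x + t • v x‖) :
    ∫ x in ball (0 : E) 1, (ContinuousLinearMap.id ℝ E + fderiv ℝ v x).det ∂μ =
      μ.real (ball (0 : E) 1) := by
  have hcont (t : ℝ) : Continuous fun x ↦ (ContinuousLinearMap.id ℝ E + t • fderiv ℝ v x).det :=
    ContinuousLinearMap.continuous_det.comp
      (continuous_const.add ((hv.continuous_fderiv one_ne_zero).const_smul t))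
  have hint (t : ℝ) : IntegrableOn
      (fun x ↦ (ContinuousLinearMap.id ℝ E + t • fderiv ℝ v x).det) (ball (0 : E) 1) μ :=
    ((hcont t).continuousOn.integrableOn_compact (isCompact_closedBall 0 1)).mono_set
      ball_subset_closedBall
  obtain ⟨C, hC⟩ := ContDiff.lipschitzWith_of_hasCompactSupport hvc hv one_ne_zero
  obtain ⟨δ, hδ, hdet⟩ : ∃ δ > 0, ∀ B : E →L[ℝ] E, ‖B‖ < δ →
      0 < (ContinuousLinearMap.id ℝ E + B).det := by
    have hc : Continuous fun B : E →L[ℝ] E ↦ (ContinuousLinearMap.id ℝ E + B).det :=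
      ContinuousLinearMap.continuous_det.comp (continuous_const.add continuous_id)
    have h0 : 0 < (ContinuousLinearMap.id ℝ E + 0).det := by
      simp [ContinuousLinearMap.det]
    obtain ⟨δ, hδ, h⟩ := Metric.eventually_nhds_iff.1 (hc.continuousAt.eventually_const_lt h0)
    exact ⟨δ, hδ, fun B hB ↦ h (by simpa using hB)⟩
  have hC1 : (0 : ℝ) < C + 1 := by positivity
  -- The inner 1 gives `t * C < 1`, hence bijectivity; `δ` keeps the determinant positive, so its
  -- absolute value can be dropped.
  have hsmall : ∀ t, 0 < t → t < min 1 (min 1 δ / (C + 1)) → ∫ x in ball (0 : E) 1,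
      (ContinuousLinearMap.id ℝ E + t • fderiv ℝ v x).det ∂μ = μ.real (ball (0 : E) 1) := by
    intro t ht0 ht
    obtain ⟨ht1, ht2⟩ := lt_min_iff.1 ht
    rw [lt_div_iff₀ hC1, lt_min_iff] at ht2
    let f : E → E := fun x ↦ x + t • v x
    have htC : t * C < 1 := by nlinarith
    have happ : ApproximatesLinearOn f (ContinuousLinearEquiv.refl ℝ E : E →L[ℝ] E) univ
        (t.toNNReal * C) := by
      intro x _ y _
      have h1 : f x - f y - (ContinuousLinearEquiv.refl ℝ E : E →L[ℝ] E) (x - y) =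
          t • (v x - v y) := by
        simp only [f, ContinuousLinearEquiv.coe_coe, ContinuousLinearEquiv.coe_refl', id,
          smul_sub]
        abel
      rw [h1, norm_smul, Real.norm_of_nonneg ht0.le, NNReal.coe_mul, Real.coe_toNNReal _ ht0.le,
        mul_assoc]
      gcongr
      simpa [dist_eq_norm] using hC.dist_le_mul x y
    have hlt : Subsingleton E ∨ t.toNNReal * C <
        ‖((ContinuousLinearEquiv.refl ℝ E).symm : E →L[ℝ] E)‖₊⁻¹ := by
      rcases subsingleton_or_nontrivial E with h | h
      · exact Or.inl h
      · right
        have : ‖((ContinuousLinearEquiv.refl ℝ E).symm : E →L[ℝ] E)‖₊ = 1 := by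
          ext
          exact ContinuousLinearMap.norm_id
        rw [this, inv_one, ← NNReal.coe_lt_coe]
        simpa [Real.coe_toNNReal _ ht0.le] using htC
    have himg : f '' ball (0 : E) 1 = ball (0 : E) 1 := by
      ext y
      simp only [mem_image, mem_ball_zero_iff]
      constructor
      · rintro ⟨x, hx, rfl⟩
        exact hin t ht0 ht1 x hx
      · intro hy
        obtain ⟨x, rfl⟩ := happ.surjective hlt y
        exact ⟨x, not_le.1 fun hx ↦ (hout t ht0 ht1 x hx).not_gt hy, rfl⟩
    have hder (x : E) : HasFDerivAt f (ContinuousLinearMap.id ℝ E + t • fderiv ℝ v x) x :=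
      (hasFDerivAt_id x).add ((hv.differentiable one_ne_zero x).hasFDerivAt.const_smul t)
    have hinj : Injective f := fun x y hxy ↦
      congrArg Subtype.val (happ.injective hlt (a₁ := ⟨x, mem_univ x⟩) (a₂ := ⟨y, mem_univ y⟩) hxy)
    have hcv := integral_image_eq_integral_abs_det_fderiv_smul μ (measurableSet_ball (x := (0 : E)) (ε := 1))
      (fun x _ ↦ (hder x).hasFDerivWithinAt) hinj.injOn
      (fun _ ↦ (1 : ℝ))
    rw [himg] at hcv
    simp only [smul_eq_mul, mul_one, integral_const, measureReal_restrict_apply_univ] at hcv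
    rw [hcv]
    refine integral_congr_ae (.of_forall fun x ↦ (abs_of_pos (hdet _ ?_)).symm)
    rw [norm_smul, Real.norm_of_nonneg ht0.le]
    have := norm_fderiv_le_of_lipschitz ℝ hC (x₀ := x)
    nlinarith
  simpa using setIntegral_det_id_add_eq_of_small μ hint (by positivity) hsmall 1

/-- There is no `C¹` retraction onto the unit sphere. The proof is the one of Milnor and Rogers. -/
theorem not_contDiff_retraction_unit_sphere {E : Type*} [NormedAddCommGroup E]
    [InnerProductSpace ℝ E] [FiniteDimensional ℝ E] {r : E → E} (hr : ContDiff ℝ 1 r)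
    (hnorm : ∀ x, ‖r x‖ = 1) (hout : ∀ x, 1 ≤ ‖x‖ → r x = ‖x‖⁻¹ • x) : False := by
  borelize E
  let χ : ContDiffBump (0 : E) := ⟨1, 2, one_pos, one_lt_two⟩
  let v : E → E := fun x ↦ χ x • (r x - x)
  have hv : ContDiff ℝ 1 v := χ.contDiff.smul (hr.sub contDiff_id)
  have hvc : HasCompactSupport v := χ.hasCompactSupport.smul_right
  have hvin (x : E) (hx : ‖x‖ < 1) : v x = r x - x := by
    have : χ x = 1 := χ.one_of_mem_closedBall (by simpa using hx.le)
    simp [v, this]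
  have key := setIntegral_ball_det_id_add_fderiv (volume : Measure E) hv hvc ?_ ?_
  · have h0 : ∀ x ∈ ball (0 : E) 1, (ContinuousLinearMap.id ℝ E + fderiv ℝ v x).det = 0 := by
      intro x hx
      have hvr : v =ᶠ[nhds x] fun y ↦ r y - y := by
        filter_upwards [isOpen_ball.mem_nhds hx] with y hy
        exact hvin y (by simpa using hy)
      have hrd := (hr.differentiable one_ne_zero x)
      have hfd : ContinuousLinearMap.id ℝ E + fderiv ℝ v x = fderiv ℝ r x := by
        rw [hvr.fderiv_eq, fderiv_fun_sub hrd differentiableAt_fun_id, fderiv_fun_id]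
        abel
      rw [hfd]
      -- An invertible derivative would have `r x` in its range, but constancy of `‖r‖` makes that
      -- range orthogonal to `r x`.
      by_contra hdet
      have hsurj : Function.Surjective (fderiv ℝ r x) := by
        have := ((fderiv ℝ r x : E →ₗ[ℝ] E).equivOfDetNeZero hdet).surjective
        exact this
      obtain ⟨w, hw⟩ := hsurj (r x)
      have hconst : (fun y ↦ inner ℝ (r y) (r y)) = fun _ ↦ (1 : ℝ) := by
        ext y; simp [hnorm]
      have h1 := congrArg (fun F ↦ fderiv ℝ F x w) hconst
      rw [fderiv_inner_apply ℝ hrd hrd] at h1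
      simp [hw, hnorm] at h1
    rw [setIntegral_congr_fun measurableSet_ball h0, integral_zero] at key
    exact (ENNReal.toReal_pos (isOpen_ball.measure_pos volume (nonempty_ball.2 one_pos)).ne'
      measure_ball_lt_top.ne).ne key
  · intro t ht0 ht1 x hx
    rw [hvin x hx, show x + t • (r x - x) = (1 - t) • x + t • r x by module]
    refine (norm_add_le _ _).trans_lt ?_
    rw [norm_smul, norm_smul, hnorm, Real.norm_of_nonneg ht0.le,
      Real.norm_of_nonneg (sub_nonneg.2 ht1.le)]
    nlinarith
  · intro t ht0 ht1 x hx
    have hx0 : 0 < ‖x‖ := by linarith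
    have hxi : ‖x‖⁻¹ * ‖x‖ = 1 := inv_mul_cancel₀ hx0.ne'
    -- Outside the ball `v` is radial and moves `x` towards the sphere without crossing it.
    have : x + t • v x = (1 + t * χ x * (‖x‖⁻¹ - 1)) • x := by
      simp only [v, hout x hx]; module
    rw [this, norm_smul, Real.norm_eq_abs]
    have hle : t * χ x ≤ 1 := mul_le_one₀ ht1.le χ.nonneg χ.le_one
    calc 1 ≤ (1 + t * χ x * (‖x‖⁻¹ - 1)) * ‖x‖ := by nlinarith
      _ ≤ _ := by gcongr; exact le_abs_self _

/-- A zero-free `φ` could be blended into the identity by a bump and normalized to a retraction.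
Where blending occurs, `‖x‖ > 1 / 2`, so a displacement of at most `1 / 2` cannot reach 0. -/
theorem exists_eq_zero_of_norm_sub_le_of_contDiff {E : Type*} [NormedAddCommGroup E]
    [InnerProductSpace ℝ E] [FiniteDimensional ℝ E] {φ : E → E} (hφ : ContDiff ℝ 1 φ)
    (hid : ∀ x, ‖x‖ ≤ 1 → ‖φ x - x‖ ≤ 1 / 2) : ∃ x, φ x = 0 := by
  by_contra! hne
  let χ : ContDiffBump (0 : E) := ⟨1 / 2, 1, by norm_num, by norm_num⟩
  let G : E → E := fun x ↦ x + χ x • (φ x - x)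
  have hG : ContDiff ℝ 1 G := contDiff_id.add (χ.contDiff.smul (hφ.sub contDiff_id))
  have hGout (x : E) (hx : 1 ≤ ‖x‖) : G x = x := by
    have : χ x = 0 := χ.zero_of_le_dist (by simpa using hx)
    simp [G, this]
  have hG0 (x : E) : G x ≠ 0 := by
    intro h
    rcases le_or_gt ‖x‖ (1 / 2) with hx | hx
    · have : χ x = 1 := χ.one_of_mem_closedBall (mem_closedBall_zero_iff.2 hx)
      exact hne x (by simpa [G, this] using h)
    rcases le_or_gt 1 ‖x‖ with hx1 | hx1
    · rw [hGout x hx1] at h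
      simp [h] at hx
      linarith
    · have h1 : ‖x‖ = ‖χ x • (φ x - x)‖ := by
        rw [← norm_neg (χ x • (φ x - x)), ← eq_neg_of_add_eq_zero_left h]
      rw [norm_smul, Real.norm_of_nonneg χ.nonneg] at h1
      have := mul_le_mul (χ.le_one (x := x)) (hid x hx1.le) (norm_nonneg _) zero_le_one
      linarith
  refine not_contDiff_retraction_unit_sphere (r := fun x ↦ ‖G x‖⁻¹ • G x)
    (((hG.norm ℝ hG0).inv fun x ↦ norm_ne_zero_iff.2 (hG0 x)).smul hG) (fun x ↦ ?_)
    fun x hx ↦ by simp only [hGout x hx]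
  rw [norm_smul, norm_inv, norm_norm, inv_mul_cancel₀ (norm_ne_zero_iff.2 (hG0 x))]

theorem ContinuousMap.exists_contDiff_dist_lt {E F : Type*} [NormedAddCommGroup E]
    [NormedSpace ℝ E] [FiniteDimensional ℝ E] [NormedAddCommGroup F] [NormedSpace ℝ F]
    [CompleteSpace F] (f : C(E, F)) {K : Set E} (hK : IsCompact K) {ε : ℝ} (hε : 0 < ε) :
    ∃ g : E → F, ContDiff ℝ ∞ g ∧ ∀ x ∈ K, dist (f x) (g x) < ε := by
  obtain ⟨g, hg, hfg⟩ := (mem_closure_iff_nhds_basis (nhds_basis_uniformity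
    (Metric.uniformity_basis_dist.compactConvergenceUniformity))).1
    (ContinuousMap.dense_setOfPred_contDiff f) (K, ε) ⟨hK, hε⟩
  exact ⟨g, hg, fun x hx ↦ by rw [dist_comm]; exact hfg x hx⟩

/-- A continuous map to a space of smaller dimension is not injective on the unit ball. -/
theorem not_injOn_closedBall_of_finrank_lt {E F : Type*} [NormedAddCommGroup E]
    [InnerProductSpace ℝ E] [FiniteDimensional ℝ E] [NormedAddCommGroup F] [NormedSpace ℝ F]
    [FiniteDimensional ℝ F] (hlt : Module.finrank ℝ F < Module.finrank ℝ E) {g : E → F}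
    (hg : ContinuousOn g (closedBall 0 1)) : ¬ InjOn g (closedBall 0 1) := by
  intro hinj
  have : CompactSpace (closedBall (0 : E) 1) :=
    isCompact_iff_compactSpace.1 (isCompact_closedBall 0 1)
  have := TietzeExtension.of_tvs ℝ (E := E)
  have := TietzeExtension.of_tvs ℝ (E := F)
  have hgc : Continuous ((closedBall (0 : E) 1).domRestrict g) := hg.domRestrict
  have hemb : Topology.IsClosedEmbedding ((closedBall (0 : E) 1).domRestrict g) :=
    hgc.isClosedEmbedding hinj.injective
  obtain ⟨H, hH⟩ := ContinuousMap.exists_extension' hemb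
    (⟨Subtype.val, continuous_subtype_val⟩ : C(closedBall (0 : E) 1, E))
  obtain ⟨g₁, hg₁⟩ := ContinuousMap.exists_restrict_eq (isClosed_closedBall (x := (0 : E)) (ε := 1))
    ⟨_, hgc⟩
  have hHg (x : E) (hx : x ∈ closedBall (0 : E) 1) : H (g₁ x) = x := by
    have h1 := congrFun hH ⟨x, hx⟩
    have h2 := DFunLike.congr_fun hg₁ ⟨x, hx⟩
    simp at h1 h2
    rw [h2, h1]
  have hK := (isCompact_closedBall (0 : E) 1).image g₁.continuous
  -- Three errors below `1 / 8` (from `Q`, `γ` and `c`) stay within the allowed `1 / 2`.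
  obtain ⟨Q, hQ, hQH⟩ := H.exists_contDiff_dist_lt hK (ε := 1 / 8) (by norm_num)
  -- Uniformity is needed at points of the compact image, not merely on it, since `γ x` may leave
  -- it.
  obtain ⟨δ, hδ, hQδ⟩ := Metric.mem_uniformity_dist.1
    (hK.uniformContinuousAt_of_continuousAt Q (fun x _ ↦ hQ.continuous.continuousAt)
      (Metric.dist_mem_uniformity (show (0 : ℝ) < 1 / 8 by norm_num)))
  obtain ⟨γ, hγ, hγg⟩ := g₁.exists_contDiff_dist_lt (isCompact_closedBall (0 : E) 1) hδ
  obtain ⟨c, hc, hcQ⟩ := (hQ.of_le (by simp) : ContDiff ℝ 1 Q).dense_compl_range_of_finrank_lt_finrank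
    hlt |>.exists_dist_lt 0 (show (0 : ℝ) < 1 / 8 by norm_num)
  obtain ⟨x, hx⟩ := exists_eq_zero_of_norm_sub_le_of_contDiff (φ := fun x ↦ Q (γ x) - c)
    (((hQ.comp hγ).sub contDiff_const).of_le (by simp)) fun x hx ↦ by
      have hx' : x ∈ closedBall (0 : E) 1 := by simpa using hx
      have h1 := hQH _ (mem_image_of_mem g₁ hx')
      have h2 : dist (Q (g₁ x)) (Q (γ x)) < 1 / 8 := hQδ (hγg x hx') (mem_image_of_mem g₁ hx')
      rw [hHg x hx', dist_eq_norm] at h1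
      rw [dist_eq_norm] at h2
      rw [dist_zero_left] at hcQ
      have h3 : Q (γ x) - c - x = -(x - Q (g₁ x)) - (Q (g₁ x) - Q (γ x)) - c := by abel
      rw [h3]
      have h4 := norm_sub_le (-(x - Q (g₁ x)) - (Q (g₁ x) - Q (γ x))) c
      have h5 := norm_sub_le (-(x - Q (g₁ x))) (Q (g₁ x) - Q (γ x))
      rw [norm_neg] at h5
      linarith
  exact hc ⟨γ x, sub_eq_zero.1 hx⟩

theorem StrictlyLeftInvertible.injective {X Y : Type*} {g : X → Y}
    (hg : StrictlyLeftInvertible g) : Function.Injective g := by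
  obtain ⟨gL, hgL⟩ := hg
  intro x y hxy
  rw [← hgL x, ← hgL y]
  exact congrArg gL (Subtype.ext hxy)

theorem IsFullDimensional.not_injective_of_continuous {m l : ℕ}
    {Ω : Set (EuclideanSpace ℝ (Fin m))} (hΩ : IsFullDimensional Ω) (hlm : l < m)
    {g : Ω → EuclideanSpace ℝ (Fin l)} (hg : Continuous g) : ¬ Function.Injective g := by
  intro hinj
  obtain ⟨U, hU, ⟨x₀, hx₀⟩, hUΩ⟩ := hΩ
  obtain ⟨ρ, hρ, hball⟩ := Metric.nhds_basis_closedBall.mem_iff.1 (hU.mem_nhds hx₀)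
  have hmem (x : EuclideanSpace ℝ (Fin m)) (hx : x ∈ closedBall (0 : EuclideanSpace ℝ (Fin m)) 1) :
      x₀ + ρ • x ∈ Ω := by
    refine hUΩ (hball ?_)
    rw [mem_closedBall_zero_iff] at hx
    rw [mem_closedBall, dist_self_add_left, norm_smul, Real.norm_of_nonneg hρ.le]
    nlinarith
  classical
  let G : EuclideanSpace ℝ (Fin m) → EuclideanSpace ℝ (Fin l) := fun x ↦
    if h : x₀ + ρ • x ∈ Ω then g ⟨_, h⟩ else 0
  have hG (x) (hx : x ∈ closedBall (0 : EuclideanSpace ℝ (Fin m)) 1) :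
      G x = g ⟨_, hmem x hx⟩ := dif_pos (hmem x hx)
  refine not_injOn_closedBall_of_finrank_lt (g := G) (by simpa using hlm) ?_ ?_
  · rw [continuousOn_iff_continuous_domRestrict]
    have : (closedBall (0 : EuclideanSpace ℝ (Fin m)) 1).domRestrict G =
        fun x : closedBall (0 : EuclideanSpace ℝ (Fin m)) 1 ↦ g ⟨_, hmem x x.2⟩ := funext fun x ↦ hG x x.2
    rw [this]
    exact hg.comp (by fun_prop)
  · intro x hx y hy hxy
    rw [hG x hx, hG y hy] at hxy
    have := congrArg Subtype.val (hinj hxy)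
    exact smul_right_injective _ hρ.ne' (add_left_cancel this)

theorem mainTheorem4 (m l : ℕ) (Ω : Set (EuclideanSpace ℝ (Fin m)))
    (hΩ : IsFullDimensional Ω) :
    (∀ g : Ω → EuclideanSpace ℝ (Fin l),
      Continuous g → StrictlyLeftInvertible g → Function.Injective g) ∧
    (l < m →
      ¬ ∃ g : Ω → EuclideanSpace ℝ (Fin l), Continuous g ∧ StrictlyLeftInvertible g) :=
  ⟨fun _ _ hg ↦ hg.injective,
    fun hlm ⟨_, hgc, hg⟩ ↦ hΩ.not_injective_of_continuous hlm hgc hg.injective⟩
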